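/- Let $n$ be the number of agents, $(\Omega,\mathcal F,\mathbb P)$ a probability space, and for each agent $i\in\{1,\dots,n\}$ let constants $0<a_i<b_i$ and $\delta_i\in(0,1/2)$ be given. Put $$S_i(a_i,b_i)=\Big\{s\in\mathbb R^n:\ s_i\in[a_i,b_i],\ s_j\le 0\ (j\ne i),\ \sum_{j=1}^n s_j=0\Big\}.$$ For each agent $i$ let $(\tilde L_i^k)_{k\ge 0}$, $\tilde L_i^k=[\tilde l_{i1}^k,\dots,\tilde l_{in}^k]$, be an independent and identically distributed (in $k$) sequence of random vectors with values almost surely in $S_i(a_i,b_i)$, and let $\tilde L^k$ be the random matrix whose $i$-th row is $\tilde L_i^k$. Agent $i$ updates at the (possibly random) times $t_i^0<t_i^1<t_i^2<\cdots$, where $t_1^0=\dots=t_n^0$; write $k_j(t)=\max\{k:\ t_j^k\le t\}$. Consider continuous states $x_1(t),\dots,x_n(t)\in\mathbb R$ which almost surely follow the distributed self-triggered algorithm $$\dot x_i(t)=-\sum_{j=1}^n \tilde l_{ij}^k\,x_j\big(t_j^{k_j(t)}\big),\qquad t\in[t_i^k,t_i^{k+1}),\quad i=1,\dots,n,\ k\ge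 0,$$ where $\dot x_i$ denotes the right derivative. Suppose that (i) almost surely, $t_i^{k+1}-t_i^k\in\big[\delta_i/\tilde l_{ii}^k,\ (1-\delta_i)/\tilde l_{ii}^k\big]$ for all $i$ and $k$; (ii) there is $\delta>0$ such that the graph with Laplacian $\mathbb E\tilde L^k$ has a $\delta$-spanning tree, that is, the directed graph on $\{1,\dots,n\}$ which has an edge from $j$ to $i$ exactly when $j\ne i$ and $-\mathbb E\,\tilde l_{ij}^k\ge\delta$ contains a spanning directed tree (one vertex, the root, has no in-neighbour in the tree, every other vertex has exactly one, and there is a directed path from the root to every other vertex). Then the algorithm reaches a consensus almost surely: with probability one there is a (random) $x^*\in\mathbb R$ such that $\lim_{t\to\infty}x_i(t)=x^*$ for all $i=1,\dots,n$. -/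

import Mathlib

open MeasureTheory ProbabilityTheory Filter Topology

namespace SelfTriggered

/-- The directed graph of a nonnegative matrix: there is an edge from `j` to `i` exactly when
the entry `A i j` is positive. -/
def graphOfMatrix {n : ℕ} (A : Matrix (Fin n) (Fin n) ℝ) : Digraph (Fin n) where
  Adj j i := 0 < A i j

open scoped Classical in
/-- The `δ`-matrix of `A`: the entries of `A` which are at least `δ` are kept, the others are
replaced by zero. -/
noncomputable def deltaMatrix {n : ℕ} (δ : ℝ) (A : Matrix (Fin n) (Fin n) ℝ) :
    Matrix (Fin n) (Fin n) ℝ :=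
  fun i j => if δ ≤ A i j then A i j else 0

/-- A directed tree: one vertex, the root, has no in-neighbour, every other vertex has exactly
one in-neighbour, and there is a directed path from the root to every other vertex. -/
def IsDirectedTree {V : Type*} (T : Digraph V) : Prop :=
  ∃ r : V, (∀ u, ¬ T.Adj u r) ∧
    ∀ v, v ≠ r → (∃! u, T.Adj u v) ∧ Relation.ReflTransGen T.Adj r v

/-- A directed graph has a spanning tree if some subgraph on the same vertex set is a directed
tree. -/
def HasSpanningTree {V : Type*} (G : Digraph V) : Prop :=
  ∃ T : Digraph V, T ≤ G ∧ IsDirectedTree T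

/-- The graph with weight matrix `A` has a `δ`-spanning tree. -/
def HasDeltaSpanningTree {n : ℕ} (δ : ℝ) (A : Matrix (Fin n) (Fin n) ℝ) : Prop :=
  HasSpanningTree (graphOfMatrix (deltaMatrix δ A))

/-- The weight matrix (without self-loops) of the graph whose Laplacian is `L`. -/
def weightOfLaplacian {n : ℕ} (L : Matrix (Fin n) (Fin n) ℝ) : Matrix (Fin n) (Fin n) ℝ :=
  fun i j => if i = j then 0 else - L i j

/-- The set `S_i(a, b)` of admissible `i`-th Laplacian rows. -/
def rowSet {n : ℕ} (i : Fin n) (a b : ℝ) : Set (Fin n → ℝ) :=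
  {s | s i ∈ Set.Icc a b ∧ (∀ j, j ≠ i → s j ≤ 0) ∧ ∑ j, s j = 0}

/-- `lastUpdate τ s = max {k : τ k ≤ s}`, the index of the latest update at or before time `s`.
It is used only for `τ 0 ≤ s` and `τ` increasing to infinity, so that the maximum exists. -/
noncomputable def lastUpdate (τ : ℕ → ℝ) (s : ℝ) : ℕ :=
  sSup {k : ℕ | τ k ≤ s}

/-- `x` is a trajectory of the distributed self-triggered algorithm in which agent `i` updates at
the times `t i 0, t i 1, …` and uses the Laplacian row `L i k` on `[t i k, t i (k + 1))`.
All agents start at the same time, so that every agent always has a latest update. The states are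
continuous and the control is piecewise constant and continuous from the right, hence the
derivative is the right derivative (it may jump at the update times of any agent). -/
structure IsTrajectory {n : ℕ} (L : Fin n → ℕ → Fin n → ℝ) (t : Fin n → ℕ → ℝ)
    (x : ℝ → Fin n → ℝ) : Prop where
  start_eq : ∀ i j, t i 0 = t j 0
  continuousOn : ∀ i, ContinuousOn (fun s => x s i) (Set.Ici (t i 0))
  hasDeriv : ∀ i k, ∀ s ∈ Set.Ico (t i k) (t i (k + 1)),
    HasDerivWithinAt (fun u => x u i)
      (- ∑ j, L i k j * x (t j (lastUpdate (t j) s)) j) (Set.Ici s) s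

/-- The agents reach a consensus: all states converge to one common real number. -/
def ReachesConsensus {n : ℕ} (x : ℝ → Fin n → ℝ) : Prop :=
  ∃ c : ℝ, ∀ i, Tendsto (fun s => x s i) atTop (𝓝 c)

end SelfTriggered

/-! Only the held values (states at the latest update) drive the dynamics. Fix an upper bound `M` of
the held values. As each row sums to zero, agent `i` moves with velocity `∑ j, L i k j * (M -
held_j)`. The timing condition makes it keep at least a fraction `θ` of its distance from `M` over
each update interval (`retain_le`), and an edge of weight at least `c` passes on a fraction `d * c`
of the neighbour's distance (`influence_le`). Hence bands `[m, M]` containing the held values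
persist. The root is at least half a width away from one end of the band. If every tree edge is
active once in each of `D` consecutive windows, this distance spreads layer by layer to all agents,
so the band shrinks by a fixed factor (`contraction`). Infinitely many such blocks give consensus.

Nothing is known about the dependence between different agents, or between update times and rows, so
blocks in real time cannot be treated as independent trials. Instead one counts by update index. A
failed block contains the start of a silent run: `N` consecutive updates of one agent with a given
tree edge inactive. Independence in `k` bounds its probability by `p ^ N` with `p < 1`. Up to `Q`
blocks there are `O(N * Q)` possible starts, so the expected number of silent runs is `O(N * p ^ N *
Q)`. For large `N`, Markov's inequality leaves fewer than `Q / 2` of them with probability near one,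
so not all late blocks can fail. -/

namespace SelfTriggered

/-! ### Held values and the spacing of update times. -/

/-- The value of agent `i` which the other agents see at time `s`: its state at its latest
update. -/
noncomputable def held {n : ℕ} (t : Fin n → ℕ → ℝ) (x : ℝ → Fin n → ℝ) (i : Fin n) (s : ℝ) : ℝ :=
  x (t i (lastUpdate (t i) s)) i

/-- A trajectory all of whose update intervals have length in `[d, τ]` and in which every agent
retains at least the fraction `θ` of its own value at each update. -/
structure IsRegularTrajectory {n : ℕ} (L : Fin n → ℕ → Fin n → ℝ) (t : Fin n → ℕ → ℝ)
    (x : ℝ → Fin n → ℝ) (d τ θ : ℝ) : Prop where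
  traj : IsTrajectory L t x
  d_pos : 0 < d
  θ_pos : 0 < θ
  le_gap : ∀ i k, d ≤ t i (k + 1) - t i k
  gap_le : ∀ i k, t i (k + 1) - t i k ≤ τ
  offdiag : ∀ i k j, j ≠ i → L i k j ≤ 0
  sum_eq : ∀ i k, ∑ j, L i k j = 0
  retain : ∀ i k, θ ≤ 1 - (t i (k + 1) - t i k) * L i k i

namespace IsRegularTrajectory

variable {n : ℕ} {L : Fin n → ℕ → Fin n → ℝ} {t : Fin n → ℕ → ℝ} {x : ℝ → Fin n → ℝ}
  {d τ θ : ℝ}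

theorem neg (H : IsRegularTrajectory L t x d τ θ) :
    IsRegularTrajectory L t (fun s i => - x s i) d τ θ where
  traj :=
    { start_eq := H.traj.start_eq
      continuousOn := fun i => (H.traj.continuousOn i).neg
      hasDeriv := fun i k s hs => by
        have h := (H.traj.hasDeriv i k s hs).fun_neg
        simpa [Finset.sum_neg_distrib] using h }
  d_pos := H.d_pos
  θ_pos := H.θ_pos
  le_gap := H.le_gap
  gap_le := H.gap_le
  offdiag := H.offdiag
  sum_eq := H.sum_eq
  retain := H.retain

theorem τ_pos (H : IsRegularTrajectory L t x d τ θ) (i : Fin n) : 0 < τ :=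
  H.d_pos.trans_le ((H.le_gap i 0).trans (H.gap_le i 0))

theorem diag_nonneg (H : IsRegularTrajectory L t x d τ θ) (i : Fin n) (k : ℕ) : 0 ≤ L i k i := by
  have h := H.sum_eq i k
  rw [← Finset.add_sum_erase _ _ (Finset.mem_univ i)] at h
  have := Finset.sum_nonpos (s := Finset.univ.erase i) (f := L i k)
    fun j hj => H.offdiag i k j (Finset.ne_of_mem_erase hj)
  linarith

theorem θ_le_one (H : IsRegularTrajectory L t x d τ θ) (i : Fin n) : θ ≤ 1 := by
  have h := mul_nonneg (H.d_pos.le.trans (H.le_gap i 0)) (H.diag_nonneg i 0)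
  linarith [H.retain i 0]

theorem strictMono (H : IsRegularTrajectory L t x d τ θ) (i : Fin n) : StrictMono (t i) :=
  strictMono_nat_of_lt_succ fun k => by linarith [H.le_gap i k, H.d_pos]

theorem mul_le_sub (H : IsRegularTrajectory L t x d τ θ) (i : Fin n) (k m : ℕ) :
    m * d ≤ t i (k + m) - t i k := by
  induction m with
  | zero => simp
  | succ m ih =>
    have := H.le_gap i (k + m)
    rw [← add_assoc]
    push_cast
    linarith

theorem sub_le_mul (H : IsRegularTrajectory L t x d τ θ) (i : Fin n) (k m : ℕ) :
    t i (k + m) - t i k ≤ m * τ := by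
  induction m with
  | zero => simp
  | succ m ih =>
    have := H.gap_le i (k + m)
    rw [← add_assoc]
    push_cast
    linarith

theorem bddAbove (H : IsRegularTrajectory L t x d τ θ) (i : Fin n) (s : ℝ) :
    BddAbove {k : ℕ | t i k ≤ s} := by
  obtain ⟨K, hK⟩ := exists_nat_gt ((s - t i 0) / d)
  refine ⟨K, fun k hk => ?_⟩
  have h1 := H.mul_le_sub i 0 k
  rw [div_lt_iff₀ H.d_pos] at hK
  rw [zero_add] at h1
  have hk' : t i k ≤ s := hk
  have h2 : (k : ℝ) * d < K * d := by linarith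
  exact_mod_cast (lt_of_mul_lt_mul_right h2 H.d_pos.le).le

theorem lastUpdate_le (H : IsRegularTrajectory L t x d τ θ) {i : Fin n} {s : ℝ}
    (hs : t i 0 ≤ s) : t i (lastUpdate (t i) s) ≤ s :=
  Nat.sSup_mem (s := {k : ℕ | t i k ≤ s}) ⟨0, hs⟩ (H.bddAbove i s)

theorem lt_lastUpdate_succ (H : IsRegularTrajectory L t x d τ θ) (i : Fin n) (s : ℝ) :
    s < t i (lastUpdate (t i) s + 1) := by
  by_contra! h
  have : lastUpdate (t i) s + 1 ≤ lastUpdate (t i) s := le_csSup (H.bddAbove i s) h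
  omega

theorem lastUpdate_eq (H : IsRegularTrajectory L t x d τ θ) {i : Fin n} {k : ℕ} {s : ℝ}
    (hs : s ∈ Set.Ico (t i k) (t i (k + 1))) : lastUpdate (t i) s = k := by
  have h0 : t i 0 ≤ s := ((H.strictMono i).monotone k.zero_le).trans hs.1
  have h1 := (H.strictMono i).lt_iff_lt.1 ((H.lastUpdate_le h0).trans_lt hs.2)
  have h2 := (H.strictMono i).lt_iff_lt.1 (hs.1.trans_lt (H.lt_lastUpdate_succ i s))
  omega

theorem held_eq (H : IsRegularTrajectory L t x d τ θ) {i : Fin n} {k : ℕ} {s : ℝ}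
    (hs : s ∈ Set.Ico (t i k) (t i (k + 1))) : held t x i s = x (t i k) i := by
  rw [held, H.lastUpdate_eq hs]

theorem mem_Ico_self (H : IsRegularTrajectory L t x d τ θ) (i : Fin n) (k : ℕ) :
    t i k ∈ Set.Ico (t i k) (t i (k + 1)) :=
  ⟨le_rfl, H.strictMono i k.lt_succ_self⟩

theorem held_update (H : IsRegularTrajectory L t x d τ θ) (i : Fin n) (k : ℕ) :
    held t x i (t i k) = x (t i k) i :=
  H.held_eq (H.mem_Ico_self i k)

theorem start_le (H : IsRegularTrajectory L t x d τ θ) (i j : Fin n) (k : ℕ) :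
    t i 0 ≤ t j k := by
  rw [H.traj.start_eq i j]
  exact (H.strictMono j).monotone k.zero_le

theorem sub_le_lastUpdate (H : IsRegularTrajectory L t x d τ θ) (i : Fin n) (s : ℝ) :
    s - τ ≤ t i (lastUpdate (t i) s) := by
  linarith [H.lt_lastUpdate_succ i s, H.gap_le i (lastUpdate (t i) s)]

/-! ### Estimates over one update interval. -/

theorem sub_drift_le (H : IsRegularTrajectory L t x d τ θ) (i : Fin n) (k : ℕ) {M B : ℝ}
    (hB : ∀ s ∈ Set.Ico (t i k) (t i (k + 1)), ∑ j, L i k j * (M - held t x j s) ≤ B)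
    {s : ℝ} (hs : s ∈ Set.Icc (t i k) (t i (k + 1))) :
    (M - x (t i k) i) - (s - t i k) * B ≤ M - x s i := by
  have hsub : Set.Icc (t i k) (t i (k + 1)) ⊆ Set.Ici (t i 0) :=
    fun u hu => (H.start_le i i k).trans hu.1
  have key := image_le_of_deriv_right_le_deriv_boundary
    (f := fun u => x u i) (f' := fun u => - ∑ j, L i k j * held t x j u)
    (a := t i k) (b := t i (k + 1)) (B := fun u => x (t i k) i + (u - t i k) * B)
    (B' := fun _ => B)
    ((H.traj.continuousOn i).mono hsub) (fun u hu => H.traj.hasDeriv i k u hu) (by simp)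
    (by fun_prop)
    (fun u _ => by
      have := (((hasDerivAt_id u).sub_const (t i k)).mul_const B).const_add (x (t i k) i)
      simpa using this.hasDerivWithinAt)
    (fun u hu => by
      have h := hB u hu
      simp only [mul_sub, Finset.sum_sub_distrib, ← Finset.sum_mul, H.sum_eq, zero_mul] at h
      linarith)
    hs
  have key' : x s i ≤ x (t i k) i + (s - t i k) * B := key
  linarith

theorem sum_offdiag (H : IsRegularTrajectory L t x d τ θ) (i : Fin n) (k : ℕ) {M s : ℝ}
    (hs : s ∈ Set.Ico (t i k) (t i (k + 1))) :
    ∑ j, L i k j * (M - held t x j s) = L i k i * (M - x (t i k) i) +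
      ∑ j ∈ Finset.univ.erase i, L i k j * (M - held t x j s) := by
  rw [← Finset.add_sum_erase _ _ (Finset.mem_univ i), H.held_eq hs]

/-- The agent feels its own held value, constant on the interval, and neighbours below `M` cannot
push it upwards any faster. So its distance from `M` shrinks at most linearly, by the factor `1 - (s
- t i k) * L i k i ≥ θ`. -/
theorem retain_le (H : IsRegularTrajectory L t x d τ θ) (i : Fin n) (k : ℕ) {M : ℝ}
    (hM : ∀ j, ∀ s ∈ Set.Ico (t i k) (t i (k + 1)), held t x j s ≤ M)
    {s : ℝ} (hs : s ∈ Set.Icc (t i k) (t i (k + 1))) :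
    θ * (M - x (t i k) i) ≤ M - x s i := by
  have h := H.sub_drift_le i k (M := M) (B := L i k i * (M - x (t i k) i)) (fun u hu => by
    rw [H.sum_offdiag i k hu]
    have := Finset.sum_nonpos (s := Finset.univ.erase i)
      (f := fun j => L i k j * (M - held t x j u)) fun j hj =>
        mul_nonpos_of_nonpos_of_nonneg (H.offdiag i k j (Finset.ne_of_mem_erase hj))
          (sub_nonneg.2 (hM j u hu))
    linarith) hs
  have h0 : 0 ≤ M - x (t i k) i := by
    rw [← H.held_update i k]
    exact sub_nonneg.2 (hM i _ (H.mem_Ico_self i k))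
  have h1 : θ ≤ 1 - (s - t i k) * L i k i := by
    have := mul_le_mul_of_nonneg_right (sub_le_sub_right hs.2 (t i k)) (H.diag_nonneg i k)
    linarith [H.retain i k]
  calc θ * (M - x (t i k) i) ≤ (1 - (s - t i k) * L i k i) * (M - x (t i k) i) :=
        mul_le_mul_of_nonneg_right h1 h0
    _ = (M - x (t i k) i) - (s - t i k) * (L i k i * (M - x (t i k) i)) := by ring
    _ ≤ _ := h

/-- Neighbour `j` lowers the drift by at least `c * e` for a time at least `d`; what the agent keeps
of its own distance is nonnegative. -/
theorem influence_le (H : IsRegularTrajectory L t x d τ θ) {i j : Fin n} (hij : j ≠ i) (k : ℕ)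
    {M e c : ℝ} (he : 0 ≤ e) (hc : 0 ≤ c) (hL : c ≤ - L i k j)
    (hM : ∀ j, ∀ s ∈ Set.Ico (t i k) (t i (k + 1)), held t x j s ≤ M)
    (hj : ∀ s ∈ Set.Ico (t i k) (t i (k + 1)), e ≤ M - held t x j s) :
    d * c * e ≤ M - x (t i (k + 1)) i := by
  have h := H.sub_drift_le i k (M := M) (B := L i k i * (M - x (t i k) i) - c * e) (fun u hu => by
    rw [H.sum_offdiag i k hu,
      ← Finset.add_sum_erase _ _ (Finset.mem_erase.2 ⟨hij, Finset.mem_univ j⟩)]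
    have := Finset.sum_nonpos (s := (Finset.univ.erase i).erase j)
      (f := fun j => L i k j * (M - held t x j u)) fun j' hj' =>
        mul_nonpos_of_nonpos_of_nonneg
          (H.offdiag i k j' (Finset.ne_of_mem_erase (Finset.mem_of_mem_erase hj')))
          (sub_nonneg.2 (hM j' u hu))
    have h2 : c * e ≤ (- L i k j) * (M - held t x j u) :=
      mul_le_mul hL (hj u hu) he (hc.trans hL)
    linarith) (Set.right_mem_Icc.2 (H.mem_Ico_self i k).2.le)
  have h0 : 0 ≤ M - x (t i k) i := by
    rw [← H.held_update i k]
    exact sub_nonneg.2 (hM i _ (H.mem_Ico_self i k))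
  have h1 := mul_nonneg (H.θ_pos.le.trans (H.retain i k)) h0
  have h2 := mul_le_mul_of_nonneg_right (H.le_gap i k) (mul_nonneg hc he)
  nlinarith

/-! ### Persistence of bounds and slow loss of distance. -/

/-- An upper bound of the held values on a time interval of length `τ` is preserved. -/
theorem held_le_of_window (H : IsRegularTrajectory L t x d τ θ) {s₀ M : ℝ}
    (h₀ : ∀ i, t i 0 ≤ s₀)
    (hM : ∀ i, ∀ s ∈ Set.Icc s₀ (s₀ + τ), held t x i s ≤ M) :
    ∀ i, ∀ s, s₀ ≤ s → held t x i s ≤ M := by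
  by_contra! hcon
  obtain ⟨i, s, hs, hlt⟩ := hcon
  let bad : Set (Fin n × ℕ) := {p | s₀ ≤ t p.1 p.2 ∧ t p.1 p.2 ≤ s ∧ M < x (t p.1 p.2) p.1}
  have hfin : bad.Finite := by
    have hsub : bad ⊆ ⋃ i : Fin n, (fun k => (i, k)) '' {k | t i k ≤ s} := by
      rintro ⟨j, k⟩ hp
      exact Set.mem_iUnion.2 ⟨j, k, hp.2.1, rfl⟩
    exact (Set.finite_iUnion fun j => ((H.bddAbove j s).finite).image _).subset hsub
  have hs0 : t i 0 ≤ s := (h₀ i).trans hs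
  have hne : bad.Nonempty := by
    refine ⟨(i, lastUpdate (t i) s), ?_, H.lastUpdate_le hs0, hlt⟩
    by_contra! hlow
    have hτ := H.τ_pos i
    have hcase : s ∉ Set.Icc s₀ (s₀ + τ) := fun hmem => absurd (hM i s hmem) (not_le.2 hlt)
    have : s₀ + τ < s := by
      by_contra! h
      exact hcase ⟨hs, h⟩
    linarith [H.sub_le_lastUpdate i s]
  -- At the earliest violating update, all held values on the preceding interval are at most `M`, so
  -- `retain_le` gives a contradiction.
  obtain ⟨⟨j, k⟩, ⟨hjk0, hjks, hjkM⟩, hmin⟩ := Set.exists_min_image bad (fun p => t p.1 p.2) hfin hne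
  simp only at hjk0 hjks hjkM hmin
  have hτ := H.τ_pos j
  have hlate : s₀ + τ < t j k := by
    by_contra! h
    have := hM j (t j k) ⟨hjk0, h⟩
    rw [H.held_update] at this
    linarith
  cases k with
  | zero => linarith [h₀ j]
  | succ k =>
    have hk0 : s₀ ≤ t j k := by linarith [H.gap_le j k]
    have hall : ∀ l, ∀ u ∈ Set.Ico (t j k) (t j (k + 1)), held t x l u ≤ M := by
      intro l u hu
      by_contra! hlu
      have hu0 : s₀ ≤ u := hk0.trans hu.1
      have hul : t l (lastUpdate (t l) u) ≤ u := H.lastUpdate_le ((h₀ l).trans hu0)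
      by_cases hl : s₀ ≤ t l (lastUpdate (t l) u)
      · have := hmin (l, lastUpdate (t l) u) ⟨hl, by linarith [hu.2], hlu⟩
        simp only at this
        linarith [hu.2]
      · push Not at hl
        have hmem : u ∈ Set.Icc s₀ (s₀ + τ) := ⟨hu0, by linarith [H.sub_le_lastUpdate l u]⟩
        linarith [hM l u hmem]
    have h := H.retain_le j k hall (Set.right_mem_Icc.2 (H.mem_Ico_self j k).2.le)
    have h1 : 0 ≤ M - x (t j k) j := by
      rw [← H.held_update j k]
      exact sub_nonneg.2 (hall j _ (H.mem_Ico_self j k))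
    linarith [mul_nonneg H.θ_pos.le h1]

/-- Gaps are at least `d`, so at most `K + 1` updates fall in `(s, s']`, each costing a factor `θ`.
The margin `τ` puts the update held at time `s` after `s₀`, where the bound `M` applies. -/
theorem decay (H : IsRegularTrajectory L t x d τ θ) {s₀ M : ℝ}
    (hM : ∀ i, ∀ s, s₀ ≤ s → held t x i s ≤ M) {K : ℕ} {i : Fin n} {s s' : ℝ}
    (h₀ : t i 0 ≤ s₀) (hs : s₀ + τ ≤ s) (hss' : s ≤ s') (hK : s' - s ≤ K * d) :
    θ ^ (K + 1) * (M - held t x i s) ≤ M - held t x i s' := by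
  have hτ := H.τ_pos i
  have hk0 : s₀ ≤ t i (lastUpdate (t i) s) := by linarith [H.sub_le_lastUpdate i s]
  set k := lastUpdate (t i) s with hk
  have hlt' : t i (lastUpdate (t i) s') ≤ s' := H.lastUpdate_le (by linarith)
  have hle : k ≤ lastUpdate (t i) s' := by
    have h1 : t i k ≤ s := H.lastUpdate_le (by linarith)
    have := (H.strictMono i).lt_iff_lt.1 ((h1.trans hss').trans_lt (H.lt_lastUpdate_succ i s'))
    omega
  obtain ⟨m, hm⟩ := Nat.exists_eq_add_of_le hle
  have hstep : ∀ m, θ ^ m * (M - x (t i k) i) ≤ M - x (t i (k + m)) i := by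
    intro m
    induction m with
    | zero => simp
    | succ m ih =>
      have h := H.retain_le i (k + m) (M := M) (fun j u hu => hM j u
        ((hk0.trans ((H.strictMono i).monotone (Nat.le_add_right k m))).trans hu.1))
        (Set.right_mem_Icc.2 (H.mem_Ico_self i (k + m)).2.le)
      calc θ ^ (m + 1) * (M - x (t i k) i) = θ * (θ ^ m * (M - x (t i k) i)) := by ring
        _ ≤ θ * (M - x (t i (k + m)) i) := mul_le_mul_of_nonneg_left ih H.θ_pos.le
        _ ≤ _ := h
  have hmK : m ≤ K + 1 := by
    by_contra! hcon
    obtain ⟨r, rfl⟩ : ∃ r, m = 1 + r := ⟨m - 1, by omega⟩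
    have h1 := H.mul_le_sub i (k + 1) r
    rw [add_assoc, ← hm] at h1
    have h2 : s < t i (k + 1) := H.lt_lastUpdate_succ i s
    have h3 : (K + 1 : ℝ) ≤ r := by exact_mod_cast (by omega : K + 1 ≤ r)
    have h4 := mul_le_mul_of_nonneg_right h3 H.d_pos.le
    linarith [H.d_pos]
  have h0 : 0 ≤ M - x (t i k) i := by
    rw [← H.held_update i k]
    exact sub_nonneg.2 (hM i _ hk0)
  calc θ ^ (K + 1) * (M - held t x i s) ≤ θ ^ m * (M - held t x i s) :=
        mul_le_mul_of_nonneg_right (pow_le_pow_of_le_one H.θ_pos.le (H.θ_le_one i) hmK) h0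
    _ ≤ M - x (t i (k + m)) i := hstep m
    _ = _ := by rw [held, hm]

end IsRegularTrajectory

/-! ### Spreading along the tree and contraction of the band. -/

/-- Every edge of `R` is active during some update interval contained in `[s, s + W]`. -/
def ActiveWindow {n : ℕ} (R : Fin n → Fin n → Prop) (L : Fin n → ℕ → Fin n → ℝ)
    (t : Fin n → ℕ → ℝ) (c s W : ℝ) : Prop :=
  ∀ u v, R u v → ∃ k, s ≤ t v k ∧ t v (k + 1) ≤ s + W ∧ c ≤ - L v k u

namespace IsRegularTrajectory

variable {n : ℕ} {L : Fin n → ℕ → Fin n → ℝ} {t : Fin n → ℕ → ℝ} {x : ℝ → Fin n → ℝ}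
  {d τ θ : ℝ}

/-- A distance of the root from the upper bound spreads to all agents. -/
theorem held_le_of_activeWindow (H : IsRegularTrajectory L t x d τ θ)
    {R : Fin n → Fin n → Prop} (hR : ∀ u v, R u v → u ≠ v) {r : Fin n} {S : ℕ → Set (Fin n)}
    {D K : ℕ} (hS0 : S 0 = {r})
    (hS : ∀ p, ∀ v ∈ S (p + 1), v ∈ S p ∨ ∃ u ∈ S p, R u v) (hSD : S D = Set.univ)
    {c W κ : ℝ} (hc : 0 ≤ c) (hW : 0 ≤ W) (hκ0 : 0 ≤ κ) (hκ1 : κ ≤ 1)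
    (hκ : κ ≤ θ ^ (K + 1) * (d * c)) (hK : D * W + τ ≤ K * d)
    {s₀ s₁ M e : ℝ} (h₀ : ∀ i, t i 0 ≤ s₀) (hs : s₀ + τ ≤ s₁)
    (hM : ∀ i, ∀ s, s₀ ≤ s → held t x i s ≤ M) (he : 0 ≤ e) (hr : e ≤ M - held t x r s₁)
    (hact : ∀ p < D, ActiveWindow R L t c (s₁ + p * W) W) :
    ∀ i, ∀ s, s₁ + D * W ≤ s → held t x i s ≤ M - κ ^ D * (θ ^ (K + 1) * e) := by
  have hτ := H.τ_pos r
  have hθ := H.θ_pos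
  -- Each layer costs a factor `κ`: one influence `d * c`, then decay until the end. The extra `τ`
  -- at the end supplies the window required by `held_le_of_window`.
  have hspread : ∀ p ≤ D, ∀ v ∈ S p, ∀ s ∈ Set.Icc (s₁ + p * W) (s₁ + D * W + τ),
      κ ^ p * (θ ^ (K + 1) * e) ≤ M - held t x v s := by
    intro p
    induction p with
    | zero =>
      intro _ v hv s hs'
      rw [hS0, Set.mem_singleton_iff] at hv
      subst hv
      simp only [Nat.cast_zero, zero_mul, add_zero] at hs'
      have h := H.decay hM (K := K) (h₀ v) hs hs'.1 (by linarith [hs'.2])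
      rw [pow_zero, one_mul]
      exact (mul_le_mul_of_nonneg_left hr (pow_nonneg hθ.le _)).trans h
    | succ p ih =>
      intro hp v hv s hs'
      have ih' := ih (by omega)
      have hE : 0 ≤ κ ^ p * (θ ^ (K + 1) * e) := by positivity
      rw [pow_succ', mul_assoc]
      push_cast at hs'
      have hpD : ((p : ℝ) + 1) * W ≤ D * W :=
        mul_le_mul_of_nonneg_right (by exact_mod_cast hp) hW
      have hpW : 0 ≤ (p : ℝ) * W := by positivity
      rcases hS p v hv with hv' | ⟨u, hu, huv⟩
      · refine le_trans ?_ (ih' v hv' s ⟨by linarith [hs'.1], hs'.2⟩)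
        exact mul_le_of_le_one_left hE hκ1
      · obtain ⟨k, hk1, hk2, hkc⟩ := hact p (by omega) u v huv
        have hinf := H.influence_le (hR u v huv) k hE hc hkc
          (fun j w hw => hM j w (by linarith [hw.1])) (fun w hw => ih' u hu w
            ⟨by linarith [hw.1], by linarith [hw.2]⟩)
        have hdec := H.decay hM (K := K) (h₀ v) (s := t v (k + 1)) (s' := s)
          (by linarith [(H.strictMono v) k.lt_succ_self]) (by linarith [hs'.1])
          (by linarith [(H.strictMono v) k.lt_succ_self, hs'.2])
        rw [H.held_update] at hdec
        calc κ * (κ ^ p * (θ ^ (K + 1) * e))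
            ≤ θ ^ (K + 1) * (d * c) * (κ ^ p * (θ ^ (K + 1) * e)) :=
              mul_le_mul_of_nonneg_right hκ hE
          _ = θ ^ (K + 1) * (d * c * (κ ^ p * (θ ^ (K + 1) * e))) := by ring
          _ ≤ θ ^ (K + 1) * (M - x (t v (k + 1)) v) :=
              mul_le_mul_of_nonneg_left hinf (by positivity)
          _ ≤ _ := hdec
  have hDW : 0 ≤ (D : ℝ) * W := by positivity
  refine H.held_le_of_window (fun i => by linarith [h₀ i]) fun i s hs' => ?_
  have := hspread D le_rfl i (by rw [hSD]; trivial) s hs'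
  linarith

theorem held_neg (i : Fin n) (s : ℝ) :
    held t (fun s i => - x s i) i s = - held t x i s := rfl

/-- All held values from time `s` on lie in `[m, M]`. -/
def _root_.SelfTriggered.HeldBand {n : ℕ} (t : Fin n → ℕ → ℝ) (x : ℝ → Fin n → ℝ)
    (s₀ m M : ℝ) : Prop :=
  (∀ i, t i 0 ≤ s₀) ∧ ∀ i, ∀ s, s₀ ≤ s → held t x i s ∈ Set.Icc m M

/-- The root is at least `(M - m) / 2` away from one end of the band. That end moves inwards; the
lower end is the upper end for the negated trajectory. -/
theorem contraction (H : IsRegularTrajectory L t x d τ θ)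
    {R : Fin n → Fin n → Prop} (hR : ∀ u v, R u v → u ≠ v) {r : Fin n} {S : ℕ → Set (Fin n)}
    {D K : ℕ} (hS0 : S 0 = {r})
    (hS : ∀ p, ∀ v ∈ S (p + 1), v ∈ S p ∨ ∃ u ∈ S p, R u v) (hSD : S D = Set.univ)
    {c W κ : ℝ} (hc : 0 ≤ c) (hW : 0 ≤ W) (hκ0 : 0 ≤ κ) (hκ1 : κ ≤ 1)
    (hκ : κ ≤ θ ^ (K + 1) * (d * c)) (hK : D * W + τ ≤ K * d)
    {s₀ s₁ m M : ℝ} (hB : HeldBand t x s₀ m M) (hs : s₀ + τ ≤ s₁)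
    (hact : ∀ p < D, ActiveWindow R L t c (s₁ + p * W) W) :
    ∃ m' M', M' - m' = (1 - κ ^ D * θ ^ (K + 1) / 2) * (M - m) ∧
      HeldBand t x (s₁ + D * W) m' M' := by
  obtain ⟨h₀, hband⟩ := hB
  have hτ := H.τ_pos r
  have hDW : 0 ≤ (D : ℝ) * W := by positivity
  have hstart : ∀ i, t i 0 ≤ s₁ + D * W := fun i => by linarith [h₀ i]
  have hmem := hband r s₁ (by linarith)
  have he : 0 ≤ (M - m) / 2 := by linarith [hmem.1.trans hmem.2]
  rcases le_total ((M - m) / 2) (M - held t x r s₁) with h | h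
  · have := H.held_le_of_activeWindow hR hS0 hS hSD hc hW hκ0 hκ1 hκ hK h₀ hs
      (fun i s hs => (hband i s hs).2) he h hact
    exact ⟨m, M - κ ^ D * (θ ^ (K + 1) * ((M - m) / 2)), by ring, hstart,
      fun i s hs' => ⟨(hband i s (by linarith)).1, this i s hs'⟩⟩
  · have := H.neg.held_le_of_activeWindow hR hS0 hS hSD hc hW hκ0 hκ1 hκ hK h₀ hs (M := -m)
      (fun i s hs => by rw [held_neg]; linarith [(hband i s hs).1]) he
      (by rw [held_neg]; linarith) hact
    refine ⟨m + κ ^ D * (θ ^ (K + 1) * ((M - m) / 2)), M, by ring, hstart,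
      fun i s hs' => ⟨?_, (hband i s (by linarith)).2⟩⟩
    have h1 := this i s hs'
    rw [held_neg] at h1
    linarith

/-! ### From shrinking bands to consensus. -/

theorem exists_heldBand (H : IsRegularTrajectory L t x d τ θ) (r : Fin n) :
    ∃ m M, HeldBand t x (t r 0) m M := by
  have hbd : ∀ i, ∃ C, ∀ s ∈ Set.Icc (t r 0) (t r 0 + τ), ‖x s i‖ ≤ C := fun i =>
    isCompact_Icc.exists_bound_of_continuousOn ((H.traj.continuousOn i).mono fun s hs => by
      rw [Set.mem_Ici, H.traj.start_eq i r]
      exact hs.1)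
  choose C hC using hbd
  obtain ⟨B, hB⟩ := (Set.finite_range C).bddAbove
  have hle : ∀ i, ∀ s ∈ Set.Icc (t r 0) (t r 0 + τ), |held t x i s| ≤ B := fun i s hs =>
    (hC i _ ⟨H.start_le r i _, (H.lastUpdate_le ((H.traj.start_eq i r).trans_le hs.1)).trans
      hs.2⟩).trans (hB ⟨i, rfl⟩)
  have h₀ : ∀ i, t i 0 ≤ t r 0 := fun i => (H.traj.start_eq i r).le
  refine ⟨-B, B, h₀, fun i s hs => ⟨?_, ?_⟩⟩
  · have := H.neg.held_le_of_window h₀ (M := B) (fun i s hs => by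
      rw [held_neg]
      linarith [abs_le.1 (hle i s hs)]) i s hs
    rw [held_neg] at this
    linarith
  · exact H.held_le_of_window h₀ (fun i s hs => (abs_le.1 (hle i s hs)).2) i s hs

/-- Between updates the state stays in the band by `retain_le`, applied to the trajectory and its
negative. -/
theorem mem_Icc_of_heldBand (H : IsRegularTrajectory L t x d τ θ) {s₀ m M : ℝ}
    (hB : HeldBand t x s₀ m M) (i : Fin n) {s : ℝ} (hs : s₀ + τ ≤ s) : x s i ∈ Set.Icc m M := by
  obtain ⟨h₀, hband⟩ := hB
  have hτ := H.τ_pos i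
  have hmem : s ∈ Set.Icc (t i (lastUpdate (t i) s)) (t i (lastUpdate (t i) s + 1)) :=
    ⟨H.lastUpdate_le (by linarith [h₀ i]), (H.lt_lastUpdate_succ i s).le⟩
  have hk : s₀ ≤ t i (lastUpdate (t i) s) := by linarith [H.sub_le_lastUpdate i s]
  have hx := hband i _ hk
  rw [H.held_update] at hx
  constructor
  · have := H.neg.retain_le i _ (M := -m) (fun j u hu => by
      rw [held_neg]
      linarith [(hband j u (hk.trans hu.1)).1]) hmem
    have h2 := mul_nonneg H.θ_pos.le (sub_nonneg.2 hx.1)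
    linarith
  · have := H.retain_le i _ (M := M) (fun j u hu => (hband j u (hk.trans hu.1)).2) hmem
    have h2 := mul_nonneg H.θ_pos.le (sub_nonneg.2 hx.2)
    linarith

theorem reachesConsensus_of_heldBand (H : IsRegularTrajectory L t x d τ θ) (r : Fin n)
    (hB : ∀ ε > 0, ∃ s₀ m M, M - m < ε ∧ HeldBand t x s₀ m M) : ReachesConsensus x := by
  have key : ∀ ε > 0, ∃ s₀, ∀ s ≥ s₀, ∀ s' ≥ s₀, ∀ i j, |x s i - x s' j| < ε := by
    intro ε hε
    obtain ⟨s₀, m, M, hlt, hband⟩ := hB ε hε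
    refine ⟨s₀ + τ, fun s hs s' hs' i j => ?_⟩
    have h1 := H.mem_Icc_of_heldBand hband i hs
    have h2 := H.mem_Icc_of_heldBand hband j hs'
    rw [abs_lt]
    constructor <;> linarith [h1.1, h1.2, h2.1, h2.2]
  have hc : CauchySeq fun s => x s r := by
    rw [Metric.cauchySeq_iff]
    intro ε hε
    obtain ⟨s₀, hs₀⟩ := key ε hε
    exact ⟨s₀, fun s hs s' hs' => hs₀ s hs s' hs' r r⟩
  obtain ⟨l, hl⟩ := cauchySeq_tendsto_of_complete hc
  refine ⟨l, fun i => ?_⟩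
  have hdiff : Tendsto (fun s => x s i - x s r) atTop (𝓝 0) := by
    rw [Metric.tendsto_atTop]
    intro ε hε
    obtain ⟨s₀, hs₀⟩ := key ε hε
    refine ⟨s₀, fun s hs => ?_⟩
    rw [Real.dist_0_eq_abs]
    exact hs₀ s hs s hs i r
  simpa using hdiff.add hl

/-- Consensus is reached if blocks of `D` active windows occur arbitrarily late. -/
theorem reachesConsensus (H : IsRegularTrajectory L t x d τ θ)
    {R : Fin n → Fin n → Prop} (hR : ∀ u v, R u v → u ≠ v) {r : Fin n} {S : ℕ → Set (Fin n)}
    {D : ℕ} (hS0 : S 0 = {r})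
    (hS : ∀ p, ∀ v ∈ S (p + 1), v ∈ S p ∨ ∃ u ∈ S p, R u v) (hSD : S D = Set.univ)
    {c W : ℝ} (hc : 0 < c) (hW : 0 ≤ W)
    (hact : ∀ s, ∃ s₁ ≥ s, ∀ p < D, ActiveWindow R L t c (s₁ + p * W) W) :
    ReachesConsensus x := by
  have hd := H.d_pos
  have hθ := H.θ_pos
  obtain ⟨K, hK⟩ := exists_nat_ge ((D * W + τ) / d)
  rw [div_le_iff₀ hd] at hK
  set κ := min 1 (θ ^ (K + 1) * (d * c)) with hκdef
  have hκ0 : 0 < κ := lt_min one_pos (by positivity)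
  have hκ1 : κ ≤ 1 := min_le_left _ _
  set ρ := 1 - κ ^ D * θ ^ (K + 1) / 2 with hρ
  have hprod0 : 0 < κ ^ D * θ ^ (K + 1) := by positivity
  have hprod1 : κ ^ D * θ ^ (K + 1) ≤ 1 :=
    mul_le_one₀ (pow_le_one₀ hκ0.le hκ1) (by positivity) (pow_le_one₀ hθ.le (H.θ_le_one r))
  have hρ0 : 0 ≤ ρ := by rw [hρ]; linarith
  have hρ1 : ρ < 1 := by rw [hρ]; linarith
  obtain ⟨m₀, M₀, hB₀⟩ := H.exists_heldBand r
  have hseq : ∀ q : ℕ, ∃ s₀ m M, M - m = ρ ^ q * (M₀ - m₀) ∧ HeldBand t x s₀ m M := by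
    intro q
    induction q with
    | zero => exact ⟨_, m₀, M₀, by simp, hB₀⟩
    | succ q ih =>
      obtain ⟨s₀, m, M, heq, hband⟩ := ih
      obtain ⟨s₁, hs₁, hwin⟩ := hact (s₀ + τ)
      obtain ⟨m', M', heq', hband'⟩ := H.contraction hR hS0 hS hSD hc.le hW hκ0.le hκ1
        (min_le_right _ _) hK hband hs₁ hwin
      exact ⟨_, m', M', by rw [heq', heq, pow_succ]; ring, hband'⟩
  refine H.reachesConsensus_of_heldBand r fun ε hε => ?_
  have hlim : Tendsto (fun q : ℕ => ρ ^ q * (M₀ - m₀)) atTop (𝓝 0) := by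
    simpa using (tendsto_pow_atTop_nhds_zero_of_lt_one hρ0 hρ1).mul_const (M₀ - m₀)
  obtain ⟨q, hq⟩ := (hlim.eventually_lt_const hε).exists
  obtain ⟨s₀, m, M, heq, hband⟩ := hseq q
  exact ⟨s₀, m, M, heq ▸ hq, hband⟩

end IsRegularTrajectory

end SelfTriggered

namespace SelfTriggered

/-! ### Layers of the tree and counting of silent runs. -/

theorem exists_layers {V : Type*} [Finite V] {R : V → V → Prop} {r : V}
    (h : ∀ v, Relation.ReflTransGen R r v) :
    ∃ (S : ℕ → Set V) (D : ℕ), S 0 = {r} ∧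
      (∀ p, ∀ v ∈ S (p + 1), v ∈ S p ∨ ∃ u ∈ S p, R u v) ∧ S D = Set.univ := by
  let S : ℕ → Set V := fun p => p.rec {r} fun _ A => A ∪ {v | ∃ u ∈ A, R u v}
  have hmono : Monotone S := monotone_nat_of_le_succ fun _ => Set.subset_union_left
  have hex : ∀ v, ∃ p, v ∈ S p := by
    intro v
    induction h v with
    | refl => exact ⟨0, rfl⟩
    | @tail u w _ huw ih =>
      obtain ⟨p, hp⟩ := ih
      exact ⟨p + 1, Or.inr ⟨u, hp, huw⟩⟩
  choose f hf using hex
  obtain ⟨D, hD⟩ := (Set.finite_range f).bddAbove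
  exact ⟨S, D, rfl, fun _ _ hv => hv,
    Set.eq_univ_of_forall fun v => hmono (hD ⟨v, rfl⟩) (hf v)⟩

/-- The edge from `u` to `v` is inactive during `N` consecutive updates of `v`, the first one
being number `k`. -/
def SilentRun {n : ℕ} (L : Fin n → ℕ → Fin n → ℝ) (c : ℝ) (N : ℕ) (e : Fin n × Fin n)
    (k : ℕ) : Prop :=
  ∀ m ∈ Finset.Ico k (k + N), - L e.2 m e.1 < c

open scoped Classical in
/-- If silent runs of length `N` are rare along infinitely many horizons, then blocks of active
windows occur arbitrarily late. -/
theorem IsRegularTrajectory.exists_activeWindow {n : ℕ} {L : Fin n → ℕ → Fin n → ℝ}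
    {t : Fin n → ℕ → ℝ} {x : ℝ → Fin n → ℝ} {d τ θ : ℝ}
    (H : IsRegularTrajectory L t x d τ θ) (r : Fin n) {R : Fin n → Fin n → Prop}
    {E : Finset (Fin n × Fin n)} (hE : ∀ u v, R u v → (u, v) ∈ E) {c : ℝ} {D N C : ℕ}
    (hC : (D + 1) * ((N + 2) * τ) < C * d)
    (hrare : ∃ᶠ Q : ℕ in atTop,
      2 * ((E ×ˢ Finset.range (C * Q)).filter fun p => SilentRun L c N p.1 p.2).card < Q)
    (s : ℝ) : ∃ s₁ ≥ s, ∀ p < D, ActiveWindow R L t c (s₁ + p * ((N + 2) * τ)) ((N + 2) * τ) := by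
  have hτ := H.τ_pos r
  have hd := H.d_pos
  set W : ℝ := (N + 2) * τ with hW
  have hWpos : 0 < W := by positivity
  -- Block length; `D + 1` rather than `D` keeps it positive when `D = 0`.
  set T : ℝ := (D + 1) * W with hT
  have hTpos : 0 < T := by positivity
  by_contra! hcon
  -- In a failed window some edge into `v` is never active, so the first update of `v` after the
  -- window opens starts a silent run.
  have hbad : ∀ q : ℕ, s ≤ t r 0 + q * T → ∃ e : Fin n × Fin n, ∃ k, e ∈ E ∧ SilentRun L c N e k ∧
      t r 0 + q * T < t e.2 k ∧ t e.2 k ≤ t r 0 + (q + 1) * T := by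
    intro q hq
    obtain ⟨p, hpD, hp⟩ := hcon _ hq
    simp only [ActiveWindow, not_forall] at hp
    obtain ⟨u, v, huv, hno⟩ := hp
    set s' := t r 0 + q * T + p * W with hs'
    have hqT : 0 ≤ (q : ℝ) * T := by positivity
    have hpW : 0 ≤ (p : ℝ) * W := by positivity
    set k := lastUpdate (t v) s' with hk
    have hk1 : s' < t v (k + 1) := H.lt_lastUpdate_succ v s'
    have hk0 : t v k ≤ s' := H.lastUpdate_le (by rw [H.traj.start_eq v r]; linarith)
    have hk2 : t v (k + 1) ≤ s' + τ := by linarith [H.gap_le v k]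
    have hpD' : ((p : ℝ) + 1) * W ≤ D * W :=
      mul_le_mul_of_nonneg_right (by exact_mod_cast hpD) hWpos.le
    have hτW : τ ≤ W := by
      have : 0 ≤ (N : ℝ) * τ := by positivity
      linarith
    refine ⟨(u, v), k + 1, hE u v huv, fun m hm => ?_, by linarith, ?_⟩
    · rw [Finset.mem_Ico] at hm
      by_contra! hcm
      refine hno ⟨m, hk1.le.trans ((H.strictMono v).monotone hm.1), ?_, hcm⟩
      obtain ⟨l, rfl⟩ := Nat.exists_eq_add_of_le hm.1
      have h1 := H.sub_le_mul v (k + 1) (l + 1)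
      have h2 : ((l + 1 : ℕ) : ℝ) * τ ≤ N * τ :=
        mul_le_mul_of_nonneg_right (by exact_mod_cast (by omega : l + 1 ≤ N)) hτ.le
      have h3 : t v (k + 1 + l + 1) - t v (k + 1) ≤ ((l + 1 : ℕ) : ℝ) * τ := h1
      linarith
    · have : t v (k + 1) ≤ t r 0 + (q + 1) * T := by
        rw [hT] at hs' ⊢
        linarith
      exact this
  obtain ⟨q₀, hq₀⟩ := exists_nat_ge ((s - t r 0) / T)
  rw [div_le_iff₀ hTpos] at hq₀
  have hbad' : ∀ q : ℕ, q₀ ≤ q → ∃ e : Fin n × Fin n, ∃ k, e ∈ E ∧ SilentRun L c N e k ∧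
      t r 0 + q * T < t e.2 k ∧ t e.2 k ≤ t r 0 + (q + 1) * T := fun q hq => hbad q (by
    have : (q₀ : ℝ) * T ≤ q * T := mul_le_mul_of_nonneg_right (by exact_mod_cast hq) hTpos.le
    linarith)
  have : Nonempty (Fin n) := ⟨r⟩
  choose! e k heE hsil hlow hup using hbad'
  obtain ⟨Q, hQ, hQ₀⟩ := (hrare.and_eventually (eventually_ge_atTop (2 * q₀))).exists
  -- The blocks `(q * T, (q + 1) * T]`, shifted by the start time, are disjoint, so the start of a
  -- run determines its block. Its index is below `C * Q` because gaps are at least `d`. Thus `Q -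
  -- q₀` is at most the number of runs, which is absurd once `Q ≥ 2 * q₀`.
  have hcard := Finset.card_le_card_of_injOn (s := Finset.Ico q₀ Q)
    (t := (E ×ˢ Finset.range (C * Q)).filter fun p => SilentRun L c N p.1 p.2)
    (fun q => (e q, k q))
    (by
      intro q hq
      simp only [Finset.coe_Ico, Set.mem_Ico] at hq
      simp only [Finset.coe_filter, Finset.mem_product, Finset.mem_range, Set.mem_ofPred_eq]
      refine ⟨⟨heE q hq.1, ?_⟩, hsil q hq.1⟩
      have h1 := H.mul_le_sub (e q).2 0 (k q)
      rw [zero_add, H.traj.start_eq (e q).2 r] at h1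
      have h2 := hup q hq.1
      have h3 : ((q : ℝ) + 1) ≤ Q := by exact_mod_cast hq.2
      have h4 : ((q : ℝ) + 1) * T ≤ Q * T := mul_le_mul_of_nonneg_right h3 hTpos.le
      have h5 : (Q : ℝ) * T < Q * (C * d) :=
        mul_lt_mul_of_pos_left hC (by have : (0 : ℝ) ≤ q := q.cast_nonneg; linarith)
      have h6 : (k q : ℝ) * d < (C * Q : ℕ) * d := by
        push_cast
        linarith
      exact_mod_cast lt_of_mul_lt_mul_right h6 hd.le)
    (by
      intro q hq q' hq' heq
      simp only [Finset.coe_Ico, Set.mem_Ico] at hq hq'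
      obtain ⟨h1, h2⟩ := Prod.mk.inj heq
      have a1 := hlow q hq.1
      have a2 := hup q hq.1
      have b1 := hlow q' hq'.1
      have b2 := hup q' hq'.1
      rw [h1, h2] at a1 a2
      have c1 : (q : ℝ) < q' + 1 := lt_of_mul_lt_mul_right (by linarith) hTpos.le
      have c2 : (q' : ℝ) < q + 1 := lt_of_mul_lt_mul_right (by linarith) hTpos.le
      have c1' : q < q' + 1 := by exact_mod_cast c1
      have c2' : q' < q + 1 := by exact_mod_cast c2
      omega)
  rw [Nat.card_Ico] at hcard
  omega

/-! ### Silent runs are rare. -/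

open scoped Classical in
/-- Events of geometrically small probability are rare along infinitely many horizons. -/
theorem ae_exists_frequently_card_lt {ι Ω : Type*} [MeasurableSpace Ω] (P : Measure Ω)
    (E : Finset ι) (A : ι → ℕ → ℕ → Set Ω) (hA : ∀ e N k, MeasurableSet (A e N k)) (p : ι → ℝ)
    (hp0 : ∀ e ∈ E, 0 ≤ p e) (hp1 : ∀ e ∈ E, p e < 1)
    (hAp : ∀ e ∈ E, ∀ N k, P (A e N k) ≤ ENNReal.ofReal (p e ^ N)) (C : ℕ) :
    ∀ᵐ ω ∂P, ∃ N : ℕ, ∃ᶠ Q : ℕ in atTop,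
      2 * ((E ×ˢ Finset.range (C * (N + 2) * Q)).filter fun q => ω ∈ A q.1 N q.2).card < Q := by
  let cnt : ℕ → ℕ → Ω → ℕ := fun N Q ω =>
    ((E ×ˢ Finset.range (C * (N + 2) * Q)).filter fun q => ω ∈ A q.1 N q.2).card
  -- Markov bound for the count at threshold `Q / 2`. The horizon `Q` cancels, and linear times
  -- geometric tends to zero in `N`.
  let η : ℕ → ℝ := fun N => ∑ e ∈ E, 2 * (C * (N + 2)) * p e ^ N
  have hη : Tendsto η atTop (𝓝 0) := by
    have : ∀ e ∈ E, Tendsto (fun N : ℕ => 2 * (C * ((N : ℝ) + 2)) * p e ^ N) atTop (𝓝 0) := by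
      intro e he
      have h1 := tendsto_self_mul_const_pow_of_lt_one (hp0 e he) (hp1 e he)
      have h2 := tendsto_pow_atTop_nhds_zero_of_lt_one (hp0 e he) (hp1 e he)
      have h3 := (h1.const_mul (2 * C : ℝ)).add (h2.const_mul (4 * C : ℝ))
      simp only [mul_zero, add_zero] at h3
      exact h3.congr fun N => by ring
    simpa using tendsto_finsetSum E this
  have hcnt : ∀ N Q ω, (cnt N Q ω : ENNReal) = ∑ q ∈ E ×ˢ Finset.range (C * (N + 2) * Q),
      (A q.1 N q.2).indicator (fun _ => (1 : ENNReal)) ω := by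
    intro N Q ω
    simp [cnt, Set.indicator_apply]
  have hlint : ∀ N Q, ∫⁻ ω, (cnt N Q ω : ENNReal) ∂P ≤
      ∑ e ∈ E, ENNReal.ofReal ((C * (N + 2) * Q) * p e ^ N) := by
    intro N Q
    simp only [hcnt, Finset.sum_product]
    rw [lintegral_finsetSum _ fun e _ => Finset.measurable_fun_sum _ fun k _ =>
      measurable_const.indicator (hA e N k)]
    refine Finset.sum_le_sum fun e he => ?_
    rw [lintegral_finsetSum _ fun k _ => measurable_const.indicator (hA e N k)]
    calc ∑ k ∈ Finset.range (C * (N + 2) * Q), ∫⁻ ω, (A e N k).indicator (fun _ => 1) ω ∂P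
        ≤ ∑ k ∈ Finset.range (C * (N + 2) * Q), ENNReal.ofReal (p e ^ N) := by
          refine Finset.sum_le_sum fun k _ => ?_
          rw [lintegral_indicator (hA e N k), setLIntegral_const, one_mul]
          exact hAp e he N k
      _ = ENNReal.ofReal ((C * (N + 2) * Q) * p e ^ N) := by
          rw [Finset.sum_const, Finset.card_range, nsmul_eq_mul,
            ENNReal.ofReal_mul (by positivity)]
          congr 1
          rw [← ENNReal.ofReal_natCast]
          push_cast
          rfl
  have hmarkov : ∀ N Q, 1 ≤ Q → P {ω | Q ≤ 2 * cnt N Q ω} ≤ ENNReal.ofReal (η N) := by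
    intro N Q hQ
    have hmeas : AEMeasurable (fun ω => 2 * (cnt N Q ω : ENNReal)) P := by
      simp only [hcnt]
      exact ((Finset.measurable_fun_sum _ fun q _ =>
        measurable_const.indicator (hA q.1 N q.2)).const_mul 2).aemeasurable
    have h1 := mul_meas_ge_le_lintegral₀ hmeas (Q : ENNReal)
    have hset : {ω | Q ≤ 2 * cnt N Q ω} = {ω | (Q : ENNReal) ≤ 2 * (cnt N Q ω : ENNReal)} := by
      ext ω
      simp only [Set.mem_ofPred_eq]
      exact_mod_cast Iff.rfl
    have h2 : ∫⁻ ω, 2 * (cnt N Q ω : ENNReal) ∂P ≤ Q * ENNReal.ofReal (η N) := by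
      rw [lintegral_const_mul' _ _ (by simp)]
      calc 2 * ∫⁻ ω, (cnt N Q ω : ENNReal) ∂P
          ≤ 2 * ∑ e ∈ E, ENNReal.ofReal ((C * (N + 2) * Q) * p e ^ N) := by gcongr; exact hlint N Q
        _ = ENNReal.ofReal (2 * ∑ e ∈ E, (C * (N + 2) * Q) * p e ^ N) := by
          rw [ENNReal.ofReal_mul (by norm_num), ENNReal.ofReal_sum_of_nonneg fun e he =>
            mul_nonneg (by positivity) (pow_nonneg (hp0 e he) N)]
          simp
        _ = ENNReal.ofReal (Q * η N) := by
          congr 1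
          simp only [η, Finset.mul_sum]
          exact Finset.sum_congr rfl fun e _ => by ring
        _ = Q * ENNReal.ofReal (η N) := by
          rw [ENNReal.ofReal_mul (by positivity), ENNReal.ofReal_natCast]
    rw [hset]
    exact (ENNReal.mul_le_mul_iff_right (by simp; omega) (by simp)).1 (h1.trans h2)
  have hev : ∀ N, P {ω | ∀ᶠ Q : ℕ in atTop, Q ≤ 2 * cnt N Q ω} ≤ ENNReal.ofReal (η N) := by
    intro N
    have hset : {ω | ∀ᶠ Q : ℕ in atTop, Q ≤ 2 * cnt N Q ω} =
        ⋃ m : ℕ, {ω | ∀ Q ≥ m, Q ≤ 2 * cnt N Q ω} := by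
      ext ω
      simp [eventually_atTop]
    have hmono : Monotone fun m : ℕ => {ω | ∀ Q ≥ m, Q ≤ 2 * cnt N Q ω} := fun m m' h ω
      (hω : ∀ Q ≥ m, Q ≤ 2 * cnt N Q ω) Q hQ => hω Q (h.trans hQ)
    rw [hset, hmono.measure_iUnion]
    -- Each set of the increasing union lies in the event of the single horizon `m + 1`, which is
    -- positive as Markov's inequality requires.
    exact iSup_le fun m => (measure_mono fun ω
      (hω : ∀ Q ≥ m, Q ≤ 2 * cnt N Q ω) => hω (m + 1) (by omega)).trans
      (hmarkov N (m + 1) (by omega))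
  have hzero : P {ω | ∀ N, ∀ᶠ Q : ℕ in atTop, Q ≤ 2 * cnt N Q ω} ≤ 0 := by
    have hlim : Tendsto (fun N => ENNReal.ofReal (η N)) atTop (𝓝 0) := by
      simpa using ENNReal.tendsto_ofReal hη
    exact ge_of_tendsto' hlim fun N => (measure_mono fun ω
      (hω : ∀ N, ∀ᶠ Q : ℕ in atTop, Q ≤ 2 * cnt N Q ω) => hω N).trans (hev N)
  rw [ae_iff]
  refine le_antisymm ((measure_mono fun ω hω => ?_).trans hzero) zero_le
  simpa only [Set.mem_ofPred_eq, not_exists, not_frequently, not_lt] using hω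

/-- The probability of a silent run of length `N` is the `N`-th power of the probability that the
edge is inactive. -/
theorem measure_silentRun {n : ℕ} {Ω : Type*} [MeasurableSpace Ω] (P : Measure Ω)
    [IsProbabilityMeasure P]
    (L : Fin n → ℕ → Ω → Fin n → ℝ) (hindep : ∀ i, iIndepFun (fun k => L i k) P)
    (hident : ∀ i k, IdentDistrib (L i k) (L i 0) P P) (c : ℝ) (e : Fin n × Fin n) (N k : ℕ) :
    P {ω | SilentRun (fun i k => L i k ω) c N e k} =
      ENNReal.ofReal (P.real {ω | - L e.2 0 ω e.1 < c} ^ N) := by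
  have hms : MeasurableSet {s : Fin n → ℝ | - s e.1 < c} :=
    measurableSet_lt (measurable_pi_apply e.1).neg measurable_const
  have h := (hindep e.2).measure_inter_preimage_eq_mul (Finset.Ico k (k + N))
    (sets := fun _ => {s : Fin n → ℝ | - s e.1 < c}) fun _ _ => hms
  have hset : {ω | SilentRun (fun i k => L i k ω) c N e k} =
      ⋂ m ∈ Finset.Ico k (k + N), L e.2 m ⁻¹' {s : Fin n → ℝ | - s e.1 < c} := by
    ext ω
    simp [SilentRun]
  rw [hset, h, Finset.prod_congr rfl fun m _ => (hident e.2 m).measure_mem_eq hms,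
    Finset.prod_const, Nat.card_Ico, Nat.add_sub_cancel_left,
    ENNReal.ofReal_pow measureReal_nonneg, ofReal_measureReal]
  rfl

theorem measurableSet_silentRun {n : ℕ} {Ω : Type*} [MeasurableSpace Ω]
    {L : Fin n → ℕ → Ω → Fin n → ℝ} (hL : ∀ i k, Measurable (L i k)) (c : ℝ) (N : ℕ)
    (e : Fin n × Fin n) (k : ℕ) :
    MeasurableSet {ω | SilentRun (fun i k => L i k ω) c N e k} := by
  simp only [SilentRun, Set.ofPred_forall]
  exact Finset.measurableSet_biInter _ fun m _ =>
    measurableSet_lt ((measurable_pi_apply e.1).comp (hL e.2 m)).neg measurable_const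

/-- If `- f < c` held almost surely, integration would give `- ∫ f ≤ c`. For non-integrable `f` the
integral is `0` by default, and `hint` contradicts `0 < c`. -/
theorem measureReal_neg_lt_lt_one {Ω : Type*} [MeasurableSpace Ω] (P : Measure Ω)
    [IsProbabilityMeasure P] {f : Ω → ℝ} (hf : Measurable f) {c : ℝ} (hc : 0 < c)
    (hint : c < - ∫ ω, f ω ∂P) : P.real {ω | - f ω < c} < 1 := by
  refine lt_of_le_of_ne measureReal_le_one fun h => ?_
  have hae : ∀ᵐ ω ∂P, - f ω < c := by
    have hm : MeasurableSet {ω | - f ω < c} := measurableSet_lt hf.neg measurable_const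
    refine (mem_ae_iff_prob_eq_one hm).2 ?_
    rw [← ofReal_measureReal (μ := P), h, ENNReal.ofReal_one]
  by_cases hi : Integrable f P
  · have := integral_mono_ae hi.neg (integrable_const c) (hae.mono fun ω hω => hω.le)
    simp [integral_neg] at this
    linarith
  · rw [integral_undef hi] at hint
    linarith

end SelfTriggered

/-! ### Constants of the algorithm and conclusion. -/

namespace SelfTriggered

theorem exists_pos_forall_le {ι : Type*} [Finite ι] [Nonempty ι] (f : ι → ℝ) (hf : ∀ i, 0 < f i) :
    ∃ m, 0 < m ∧ ∀ i, m ≤ f i := by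
  obtain ⟨i, hi⟩ := Finite.exists_min f
  exact ⟨f i, hf i, hi⟩

theorem isRegularTrajectory_of_rowSet {n : ℕ} {a b δ : Fin n → ℝ} (ha : ∀ i, 0 < a i)
    (hδ : ∀ i, δ i ∈ Set.Ioo (0 : ℝ) (1 / 2)) {d τ θ : ℝ} (hd : 0 < d) (hθ : 0 < θ)
    (hdi : ∀ i, d ≤ δ i / b i) (hτi : ∀ i, (1 - δ i) / a i ≤ τ) (hθi : ∀ i, θ ≤ δ i)
    {L : Fin n → ℕ → Fin n → ℝ} {t : Fin n → ℕ → ℝ} {x : ℝ → Fin n → ℝ}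
    (hL : ∀ i k, L i k ∈ rowSet i (a i) (b i))
    (ht : ∀ i k, t i (k + 1) - t i k ∈ Set.Icc (δ i / L i k i) ((1 - δ i) / L i k i))
    (hx : IsTrajectory L t x) : IsRegularTrajectory L t x d τ θ where
  traj := hx
  d_pos := hd
  θ_pos := hθ
  le_gap i k := (hdi i).trans ((div_le_div_of_nonneg_left (hδ i).1.le
    ((ha i).trans_le (hL i k).1.1) (hL i k).1.2).trans (ht i k).1)
  gap_le i k := (ht i k).2.trans ((div_le_div_of_nonneg_left (by linarith [(hδ i).2]) (ha i)
    (hL i k).1.1).trans (hτi i))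
  offdiag i k j hj := (hL i k).2.1 j hj
  sum_eq i k := (hL i k).2.2
  retain i k := by
    have h := (le_div_iff₀ ((ha i).trans_le (hL i k).1.1)).1 (ht i k).2
    linarith [hθi i]

end SelfTriggered

theorem mainTheorem5 {n : ℕ} {Ω : Type*} [MeasurableSpace Ω] (P : Measure Ω)
    [IsProbabilityMeasure P]
    -- bounds of the Laplacian rows and timing parameters of the agents
    (a b δ : Fin n → ℝ) (ha : ∀ i, 0 < a i) (hab : ∀ i, a i < b i)
    (hδ : ∀ i, δ i ∈ Set.Ioo (0 : ℝ) (1 / 2))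
    -- `L i k` is the random Laplacian row drawn by agent `i` at its `k`-th update
    (L : Fin n → ℕ → Ω → Fin n → ℝ) (hL_meas : ∀ i k, Measurable (L i k))
    (hL_mem : ∀ᵐ ω ∂P, ∀ i k, L i k ω ∈ SelfTriggered.rowSet i (a i) (b i))
    (hL_indep : ∀ i, iIndepFun (fun k => L i k) P)
    (hL_ident : ∀ i k, IdentDistrib (L i k) (L i 0) P P)
    -- `t i k` is the (random) time of the `k`-th update of agent `i`
    (t : Fin n → ℕ → Ω → ℝ)
    (ht : ∀ᵐ ω ∂P, ∀ i k, t i (k + 1) ω - t i k ω ∈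
      Set.Icc (δ i / L i k ω i) ((1 - δ i) / L i k ω i))
    -- the graph with Laplacian `E L^k` has a spanning tree with weights bounded below
    (hTree : ∃ ε : ℝ, 0 < ε ∧ ∀ k, SelfTriggered.HasDeltaSpanningTree ε
      (SelfTriggered.weightOfLaplacian (fun i j => ∫ ω, L i k ω j ∂P)))
    -- the states of the agents
    (x : Ω → ℝ → Fin n → ℝ)
    (hx : ∀ᵐ ω ∂P, SelfTriggered.IsTrajectory (fun i k => L i k ω) (fun i k => t i k ω) (x ω)) :
    ∀ᵐ ω ∂P, SelfTriggered.ReachesConsensus (x ω) := by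
  classical
  obtain ⟨ε, hε, hT⟩ := hTree
  -- The rows are identically distributed in `k`, so the tree at `k = 0` serves for all updates.
  obtain ⟨T, hTG, r, -, hr⟩ := hT 0
  have hedge : ∀ u v, T.Adj u v → u ≠ v ∧ ε ≤ - ∫ ω, L v 0 ω u ∂P := by
    intro u v huv
    have h : 0 < SelfTriggered.deltaMatrix ε
      (SelfTriggered.weightOfLaplacian (fun i j => ∫ ω, L i 0 ω j ∂P)) v u := hTG huv
    simp only [SelfTriggered.deltaMatrix] at h
    split_ifs at h with h1
    · simp only [SelfTriggered.weightOfLaplacian] at h1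
      split_ifs at h1 with h2
      · linarith
      · exact ⟨fun h3 => h2 h3.symm, h1⟩
    · exact absurd h (lt_irrefl 0)
  obtain ⟨S, D, hS0, hS, hSD⟩ := SelfTriggered.exists_layers (R := T.Adj) (r := r) fun v => by
    by_cases hv : v = r
    · rw [hv]
    · exact (hr v hv).2
  have : Nonempty (Fin n) := ⟨r⟩
  obtain ⟨d, hd, hdi⟩ := SelfTriggered.exists_pos_forall_le (fun i => δ i / b i)
    fun i => div_pos (hδ i).1 ((ha i).trans (hab i))
  obtain ⟨θ, hθ, hθi⟩ := SelfTriggered.exists_pos_forall_le δ fun i => (hδ i).1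
  obtain ⟨τ, hτi⟩ := (Set.finite_range fun i => (1 - δ i) / a i).bddAbove
  -- Chosen independently of `N`, which will depend on `ω`; the factor `N + 2` of the window length
  -- is restored at the end.
  obtain ⟨C, hC⟩ := exists_nat_gt ((D + 1) * τ / d)
  rw [div_lt_iff₀ hd] at hC
  have hrare := SelfTriggered.ae_exists_frequently_card_lt P
    (Finset.univ.filter fun e : Fin n × Fin n => T.Adj e.1 e.2)
    (fun e N k => {ω | SelfTriggered.SilentRun (fun i k => L i k ω) (ε / 2) N e k})
    (fun e N k => SelfTriggered.measurableSet_silentRun hL_meas (ε / 2) N e k)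
    -- The threshold `ε / 2` lies strictly below the mean weight, which makes this probability less
    -- than one.
    (fun e => P.real {ω | - L e.2 0 ω e.1 < ε / 2})
    (fun _ _ => measureReal_nonneg)
    (fun e he => SelfTriggered.measureReal_neg_lt_lt_one P
      ((measurable_pi_apply e.1).comp (hL_meas e.2 0)) (half_pos hε)
      ((half_lt_self hε).trans_le (hedge e.1 e.2 (Finset.mem_filter.1 he).2).2))
    (fun e _ N k =>
      (SelfTriggered.measure_silentRun P L hL_indep hL_ident (ε / 2) e N k).le) C
  filter_upwards [hL_mem, ht, hx, hrare] with ω hLω htω hxω ⟨N, hN⟩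
  have H := SelfTriggered.isRegularTrajectory_of_rowSet ha hδ hd hθ hdi
    (fun i => hτi ⟨i, rfl⟩) hθi hLω htω hxω
  have hτ := H.τ_pos r
  refine H.reachesConsensus (fun u v huv => (hedge u v huv).1) hS0 hS hSD (half_pos hε)
    (W := (N + 2) * τ) (by positivity) fun s => ?_
  refine H.exists_activeWindow r (C := C * (N + 2)) (fun u v huv => by simpa using huv) ?_ hN s
  have := mul_lt_mul_of_pos_left hC (by positivity : (0 : ℝ) < N + 2)
  push_cast
  linarith
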